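/- **Setting.** Let $I=[0,1]$. A *bimodal* map is a continuous $f:I\to I$ with $f(\{0,1\})=\{0,1\}$ which has two turning points $0<c<d<1$, being strictly monotone on each of $[0,c]$, $[c,d]$, $[d,1]$, with alternating directions. It is *negative* if $f(0)=1$, $f(1)=0$. Write $\omega(x)=\bigcap_N\overline{\{f^n(x):n\ge N\}}$; $x$ is *recurrent* if $x\in\omega(x)$. For $T\subset I$ let $D(T)=\{x\in I: f^k(x)\in T\text{ for some }k\ge1\}$, let $R_T(x)=f^{k(x)}(x)$ for $x\in D(T)$, where $k(x)\ge1$ is the least such $k$, and let $\mathcal L_x(T)$ be the component of $D(T)$ containing $x$. The first return map of $T$ is $R_T|_{D(T)\cap T}$, and its *return domains* are the components of $D(T)\cap T$. Let $\mathscr B_*$ be the class of $C^3$ bimodal maps $f$ such that: $f$ has no wandering interval (a nondegenerate interval whose images $f^n(W)$, $n\ge 0$, are pairwise disjoint and whose $\omega$-limit set is not a single periodic orbit); all periodic cycles of $f$ are hyperbolic repelling; $f\circ h=h\circ f$ for some orientation-reversing homeomorphism $h:I\to I$; $c$ and $d$ are recurrent; and $\omega(c)=\omega(d)$. *Twin principal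 nest.* If there is a fixed point $p\in(c,d)$ and $p_1<p<p_2$ with $f(p_1)=f(p_2)=p$, put $I^0=(p_1,p)$, $J^0=(p,p_2)$. If $f$ is negative with a single fixed point $p$ and $f^{-1}(p)=\{p,p_1,p_2\}$, put $I^0=(p,p_1)$, $J^0=(p_1,p_2)$ when $p<p_1<p_2$, and $I^0=(p_1,p_2)$, $J^0=(p_2,p)$ when $p_1<p_2<p$. For $n\ge1$ let $I^n=\mathcal L_c(I^{n-1}\cup J^{n-1})$ and $J^n=\mathcal L_d(I^{n-1}\cup J^{n-1})$. Let $g_0=f$, and for $n\ge1$ let $g_n$ be the first return map of $I^{n-1}\cup J^{n-1}$. Let $\mathscr G$ be the class of $f\in\mathscr B_*$ having such $I^0,J^0$ and satisfying: 1. $f(c),f(d)\notin I^0\cup J^0$, while $f^i(c),f^i(d)\in I^0\cup J^0$ for $i=2,3$; 2. for each $n\ge1$, $g_n(c),g_n(d)\notin I^n\cup J^n$, and the return domains of $g_n$ containing $g_n(c)$ and $g_n(d)$ are, in some order, sets $C^n\subset I^{n-1}$ and $D^n\subset J^{n-1}$; 3. for each $n\ge1$, $I^n\cup J^n\subset g_n(I^n\cup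 J^n)$; 4. for each $n\ge1$, $(\omega(c)\cup\omega(d))\cap(I^{n-1}\cup J^{n-1})\subset I^n\cup J^n\cup C^n\cup D^n$; 5. for each $n\ge1$, $g_n|_{I^n\cup J^n}=g_{n-1}^{r_n}|_{I^n\cup J^n}$ for some integer $r_n\ge2$; 6. for each $n\ge1$, $g_n|_{C^n\cup D^n}=g_{n-1}^{t_n}|_{C^n\cup D^n}$ for some integer $t_n\ge1$. Let $\mathscr C$ be the class of $f\in\mathscr G$ of the form $f(x)=ax^3+bx^2+(1-a-b)x$ or $f(x)=1-ax^3-bx^2-(1-a-b)x$ on $I$, with $a,b\in\mathbb R$. **Lemma 2.7.** Let $f\in\mathscr C$ with turning points $c<d$. Then $\omega(c)=\omega(d)$; this set $\Omega\subset I$ is invariant, $f(\Omega)=\Omega$; it is minimal, i.e. nonempty and closed, and no nonempty closed proper subset $Y\subset\Omega$ satisfies $f(Y)\subset Y$; and it is a Cantor set, i.e. nonempty, compact, perfect and totally disconnected. -/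

import Mathlib

open Set Filter

namespace Bimodal

/-! ### General dynamics

An interval map is a function `f : ℝ → ℝ` of which only the restriction to `[0, 1]` is used;
all notions below look at points of `[0, 1]` only. -/

/-- The phase space `[0, 1]`. -/
abbrev phase : Set ℝ := Icc 0 1

/-- The `ω`-limit set of the point `x`, that is `⋂ N, closure {f^n x | n ≥ N}`. -/
def omega (f : ℝ → ℝ) (x : ℝ) : Set ℝ :=
  omegaLimit atTop (fun n : ℕ => f^[n]) {x}

/-- `x` is recurrent. -/
def IsRecurrent (f : ℝ → ℝ) (x : ℝ) : Prop := x ∈ omega f x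

/-- The domain `D(T)` of the first entry map into `T`. -/
def entryDomain (f : ℝ → ℝ) (T : Set ℝ) : Set ℝ :=
  {x | x ∈ phase ∧ ∃ k : ℕ, 1 ≤ k ∧ f^[k] x ∈ T}

/-- The entry time: the least `k ≥ 1` with `f^k x ∈ T` (meaningful on `entryDomain f T`). -/
noncomputable def entryTime (f : ℝ → ℝ) (T : Set ℝ) (x : ℝ) : ℕ :=
  sInf {k : ℕ | 1 ≤ k ∧ f^[k] x ∈ T}

/-- The first entry map `R_T` (meaningful on `entryDomain f T`). Its restriction to
`entryDomain f T ∩ T` is the first return map of `T`. -/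
noncomputable def firstEntry (f : ℝ → ℝ) (T : Set ℝ) (x : ℝ) : ℝ :=
  f^[entryTime f T x] x

/-- `𝓛_x(T)`: the component of `D(T)` containing `x` (empty if `x ∉ D(T)`). -/
def entryComponent (f : ℝ → ℝ) (T : Set ℝ) (x : ℝ) : Set ℝ :=
  connectedComponentIn (entryDomain f T) x

/-- The return domain of `T` containing `x`: the component of `D(T) ∩ T` containing `x`
(empty if `x ∉ D(T) ∩ T`). -/
def returnComponent (f : ℝ → ℝ) (T : Set ℝ) (x : ℝ) : Set ℝ :=
  connectedComponentIn (entryDomain f T ∩ T) x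

/-- `W` is a wandering interval: a nondegenerate subinterval of `[0, 1]` whose images are
pairwise disjoint and do not accumulate exactly on one periodic orbit. -/
def IsWanderingInterval (f : ℝ → ℝ) (W : Set ℝ) : Prop :=
  W ⊆ phase ∧ W.OrdConnected ∧ W.Nontrivial ∧
  (∀ i j : ℕ, i ≠ j → Disjoint (f^[i] '' W) (f^[j] '' W)) ∧
  ¬ ∃ q ∈ phase, (∃ m : ℕ, 1 ≤ m ∧ f^[m] q = q) ∧
    omegaLimit atTop (fun n : ℕ => f^[n]) W = Set.range (fun n : ℕ => f^[n] q)

/-- Every periodic cycle in `[0, 1]` is hyperbolic repelling (at the end points `0`, `1` the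
derivative is one-sided). -/
def AllCyclesRepelling (f : ℝ → ℝ) : Prop :=
  ∀ x ∈ phase, ∀ n : ℕ, 1 ≤ n → f^[n] x = x → 1 < |derivWithin (f^[n]) phase x|

/-! ### Bimodal maps -/

/-- `f` restricts to a bimodal map of `[0, 1]` with turning points `c < d`. -/
structure IsBimodal (f : ℝ → ℝ) (c d : ℝ) : Prop where
  continuousOn : ContinuousOn f phase
  mapsTo : MapsTo f phase phase
  image_ends : f '' {0, 1} = {0, 1}
  zero_lt : 0 < c
  lt : c < d
  lt_one : d < 1
  laps :
    (StrictMonoOn f (Icc 0 c) ∧ StrictAntiOn f (Icc c d) ∧ StrictMonoOn f (Icc d 1)) ∨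
    (StrictAntiOn f (Icc 0 c) ∧ StrictMonoOn f (Icc c d) ∧ StrictAntiOn f (Icc d 1))

/-- `f` permutes the end points. -/
def IsNegative (f : ℝ → ℝ) : Prop := f 0 = 1 ∧ f 1 = 0

/-- The class `𝓑`: `C³` bimodal maps without wandering intervals, all of whose periodic cycles
are hyperbolic repelling. -/
structure ClassB (f : ℝ → ℝ) (c d : ℝ) : Prop where
  bimodal : IsBimodal f c d
  contDiffOn : ContDiffOn ℝ 3 f phase
  no_wandering : ¬ ∃ W : Set ℝ, IsWanderingInterval f W
  repelling : AllCyclesRepelling f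

/-- `f` commutes with some orientation-reversing homeomorphism of `[0, 1]`. -/
def CombinatoriallySymmetric (f : ℝ → ℝ) : Prop :=
  ∃ h : ℝ → ℝ, ContinuousOn h phase ∧ BijOn h phase phase ∧ StrictAntiOn h phase ∧
    ∀ x ∈ phase, h (f x) = f (h x)

/-- The class `𝓑_*`: combinatorially symmetric maps in `𝓑` with recurrent turning points that
have the same `ω`-limit set. -/
structure ClassBStar (f : ℝ → ℝ) (c d : ℝ) : Prop where
  classB : ClassB f c d
  symmetric : CombinatoriallySymmetric f
  recurrent_c : IsRecurrent f c
  recurrent_d : IsRecurrent f d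
  omega_eq : omega f c = omega f d

/-! ### The twin principal nest -/

/-- The starting intervals `I⁰`, `J⁰` of the nest. Either there is a fixed point `p` between the
turning points, and they are `(p₁, p)`, `(p, p₂)` where `p₁ < p < p₂` and `f p₁ = f p₂ = p`; or
`f` is negative, has a single fixed point `p`, and `p` has exactly two further preimages
`p₁ < p₂`, both to the right or both to the left of `p`. (A negative map whose single fixed point
is its own only preimage has no starting intervals; such a map commutes with no
orientation-reversing homeomorphism, which would have to fix `p` and exchange the turning
points, while both of these lie on one side of `p`.) -/
def IsStartingPair (f : ℝ → ℝ) (c d : ℝ) (I₀ J₀ : Set ℝ) : Prop :=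
  ∃ p ∈ phase, ∃ p₁ ∈ phase, ∃ p₂ ∈ phase, f p = p ∧ f p₁ = p ∧ f p₂ = p ∧
    ((p ∈ Ioo c d ∧ p₁ < p ∧ p < p₂ ∧ I₀ = Ioo p₁ p ∧ J₀ = Ioo p p₂) ∨
     (IsNegative f ∧ (∀ x ∈ phase, f x = x → x = p) ∧
      (∀ x ∈ phase, f x = p → x = p ∨ x = p₁ ∨ x = p₂) ∧
      ((p < p₁ ∧ p₁ < p₂ ∧ I₀ = Ioo p p₁ ∧ J₀ = Ioo p₁ p₂) ∨
       (p₁ < p₂ ∧ p₂ < p ∧ I₀ = Ioo p₁ p₂ ∧ J₀ = Ioo p₂ p))))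

/-- The twin principal nest: the pair `(Iⁿ, Jⁿ)` with `Iⁿ⁺¹ = 𝓛_c(Iⁿ ∪ Jⁿ)` and
`Jⁿ⁺¹ = 𝓛_d(Iⁿ ∪ Jⁿ)`. -/
def nest (f : ℝ → ℝ) (c d : ℝ) (I₀ J₀ : Set ℝ) : ℕ → Set ℝ × Set ℝ
  | 0 => (I₀, J₀)
  | n + 1 =>
    (entryComponent f ((nest f c d I₀ J₀ n).1 ∪ (nest f c d I₀ J₀ n).2) c,
     entryComponent f ((nest f c d I₀ J₀ n).1 ∪ (nest f c d I₀ J₀ n).2) d)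

/-- The set to which `gₙ` is the first return map: `[0, 1]` for `n = 0` (so that `g₀ = f`), and
`Iⁿ⁻¹ ∪ Jⁿ⁻¹` for `n ≥ 1`. -/
def level (f : ℝ → ℝ) (c d : ℝ) (I₀ J₀ : Set ℝ) : ℕ → Set ℝ
  | 0 => phase
  | n + 1 => (nest f c d I₀ J₀ n).1 ∪ (nest f c d I₀ J₀ n).2

/-- The first return map `gₙ` to `level n` (meaningful on `returnDom n`). -/
noncomputable def returnMap (f : ℝ → ℝ) (c d : ℝ) (I₀ J₀ : Set ℝ) (n : ℕ) : ℝ → ℝ :=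
  firstEntry f (level f c d I₀ J₀ n)

/-- The domain of `gₙ`. -/
def returnDom (f : ℝ → ℝ) (c d : ℝ) (I₀ J₀ : Set ℝ) (n : ℕ) : Set ℝ :=
  entryDomain f (level f c d I₀ J₀ n) ∩ level f c d I₀ J₀ n

/-- `gₙ₊₁ = gₙ ∘ ⋯ ∘ gₙ` (`r` factors) on `S`, the composition being defined on `S`. -/
def ReturnMapEqIterateOn (f : ℝ → ℝ) (c d : ℝ) (I₀ J₀ : Set ℝ) (n r : ℕ) (S : Set ℝ) : Prop :=
  ∀ x ∈ S, (∀ i < r, (returnMap f c d I₀ J₀ n)^[i] x ∈ returnDom f c d I₀ J₀ n) ∧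
    returnMap f c d I₀ J₀ (n + 1) x = (returnMap f c d I₀ J₀ n)^[r] x

/-- `gₙ` is a non-central return: neither `gₙ(c)` nor `gₙ(d)` lies in `Iⁿ ∪ Jⁿ`. -/
def IsNonCentral (f : ℝ → ℝ) (c d : ℝ) (I₀ J₀ : Set ℝ) (n : ℕ) : Prop :=
  returnMap f c d I₀ J₀ n c ∉ (nest f c d I₀ J₀ n).1 ∪ (nest f c d I₀ J₀ n).2 ∧
  returnMap f c d I₀ J₀ n d ∉ (nest f c d I₀ J₀ n).1 ∪ (nest f c d I₀ J₀ n).2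

/-- `C` and `D` are the return domains of `gₙ` that contain `gₙ(c)` and `gₙ(d)`, in one of the
two orders. -/
def AreValueDomains (f : ℝ → ℝ) (c d : ℝ) (I₀ J₀ : Set ℝ) (n : ℕ) (C D : Set ℝ) : Prop :=
  returnMap f c d I₀ J₀ n c ∈ returnDom f c d I₀ J₀ n ∧
  returnMap f c d I₀ J₀ n d ∈ returnDom f c d I₀ J₀ n ∧
  ((C = returnComponent f (level f c d I₀ J₀ n) (returnMap f c d I₀ J₀ n c) ∧
    D = returnComponent f (level f c d I₀ J₀ n) (returnMap f c d I₀ J₀ n d)) ∨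
   (C = returnComponent f (level f c d I₀ J₀ n) (returnMap f c d I₀ J₀ n d) ∧
    D = returnComponent f (level f c d I₀ J₀ n) (returnMap f c d I₀ J₀ n c)))

/-- The class `𝓖`. Here `I₀`, `J₀` start the twin principal nest and `C n`, `D n` are the two
non-central return domains; in the fields, `n + 1` runs through the levels `≥ 1`. -/
structure IsGeneralizedFibonacci (f : ℝ → ℝ) (c d : ℝ) (I₀ J₀ : Set ℝ) (C D : ℕ → Set ℝ) :
    Prop where
  starting : IsStartingPair f c d I₀ J₀
  values : f c ∉ I₀ ∪ J₀ ∧ f d ∉ I₀ ∪ J₀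
  values_two : f^[2] c ∈ I₀ ∪ J₀ ∧ f^[2] d ∈ I₀ ∪ J₀
  values_three : f^[3] c ∈ I₀ ∪ J₀ ∧ f^[3] d ∈ I₀ ∪ J₀
  nonCentral : ∀ n : ℕ, IsNonCentral f c d I₀ J₀ (n + 1)
  valueDomains : ∀ n : ℕ, AreValueDomains f c d I₀ J₀ (n + 1) (C (n + 1)) (D (n + 1))
  left_subset : ∀ n : ℕ, C (n + 1) ⊆ (nest f c d I₀ J₀ n).1
  right_subset : ∀ n : ℕ, D (n + 1) ⊆ (nest f c d I₀ J₀ n).2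
  high_return : ∀ n : ℕ,
    (nest f c d I₀ J₀ (n + 1)).1 ∪ (nest f c d I₀ J₀ (n + 1)).2 ⊆
      returnMap f c d I₀ J₀ (n + 1) ''
        ((nest f c d I₀ J₀ (n + 1)).1 ∪ (nest f c d I₀ J₀ (n + 1)).2)
  omega_subset : ∀ n : ℕ,
    (omega f c ∪ omega f d) ∩ ((nest f c d I₀ J₀ n).1 ∪ (nest f c d I₀ J₀ n).2) ⊆
      (nest f c d I₀ J₀ (n + 1)).1 ∪ (nest f c d I₀ J₀ (n + 1)).2 ∪ C (n + 1) ∪ D (n + 1)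
  central_iterate : ∀ n : ℕ, ∃ r : ℕ, 2 ≤ r ∧
    ReturnMapEqIterateOn f c d I₀ J₀ n r
      ((nest f c d I₀ J₀ (n + 1)).1 ∪ (nest f c d I₀ J₀ (n + 1)).2)
  noncentral_iterate : ∀ n : ℕ, ∃ t : ℕ, 1 ≤ t ∧
    ReturnMapEqIterateOn f c d I₀ J₀ n t (C (n + 1) ∪ D (n + 1))

/-- `f`, with turning points `c < d`, belongs to the class `𝓖`. -/
def ClassG (f : ℝ → ℝ) (c d : ℝ) : Prop :=
  ClassBStar f c d ∧
    ∃ (I₀ J₀ : Set ℝ) (C D : ℕ → Set ℝ), IsGeneralizedFibonacci f c d I₀ J₀ C D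

/-- The positive family `a x³ + b x² + (1 - a - b) x`. -/
def cubicPos (a b x : ℝ) : ℝ := a * x ^ 3 + b * x ^ 2 + (1 - a - b) * x

/-- The negative family `1 - a x³ - b x² - (1 - a - b) x`. -/
def cubicNeg (a b x : ℝ) : ℝ := 1 - a * x ^ 3 - b * x ^ 2 - (1 - a - b) * x

/-- `f`, with turning points `c < d`, belongs to the class `𝓒`: it is in `𝓖` and is, on `[0, 1]`,
one of the cubic polynomials of the two families. -/
def ClassC (f : ℝ → ℝ) (c d : ℝ) : Prop :=
  ClassG f c d ∧ ∃ a b : ℝ, EqOn f (cubicPos a b) phase ∨ EqOn f (cubicNeg a b) phase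

/-! ### Minimal sets and Cantor sets -/

/-- A nonempty closed invariant set without proper nonempty closed forward invariant subsets. -/
structure IsMinimalSet (f : ℝ → ℝ) (X : Set ℝ) : Prop where
  nonempty : X.Nonempty
  isClosed : IsClosed X
  mapsTo : MapsTo f X X
  eq_of_subset : ∀ Y ⊆ X, Y.Nonempty → IsClosed Y → MapsTo f Y Y → Y = X

/-- A Cantor set: nonempty, compact, perfect and totally disconnected. -/
structure IsCantorSet (X : Set ℝ) : Prop where
  nonempty : X.Nonempty
  isCompact : IsCompact X
  perfect : Perfect X
  totallyDisconnected : IsTotallyDisconnected X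

end Bimodal

/-! The turning points are critical and every cycle is repelling, so `c` and `d` are not periodic.
Being recurrent, they have orbits without repetition, and `perfect_omega` follows. Minimality rests
on the nest. Each level is nice: its boundary points never enter it. Hence entry times are constant
on entry components (`IsNice.entryTime_eq`). Since the central return is at least a second iterate
of the previous one, the entry times of `c` and `d` grow strictly with the level
(`strictMono_entryTime`). A nondegenerate intersection of the components around `c` or `d` would
then be a wandering interval, so the components shrink to the turning points
(`iInter_entryComponent_subset`). Inside a level, the limit set lies in four return domains, so
return times are bounded and every orbit in the limit set comes to the closure of every level
(`exists_iterate_mem_closure`). By compactness a nonempty closed invariant subset contains `c` or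
`d`, hence all of `omega f c = omega f d`. An interval in this minimal set would yield a periodic
orbit in it, which minimality would make the whole set; but the set is infinite. -/

namespace Bimodal

open Topology Function

/-! ### Limit sets of recurrent points: invariance, perfectness, total disconnectedness. -/

section Omega

variable {f : ℝ → ℝ} {x y : ℝ}

theorem continuousOn_iterate_phase (hc : ContinuousOn f phase) (hm : MapsTo f phase phase)
    (n : ℕ) : ContinuousOn f^[n] phase := by
  induction n with
  | zero => exact continuousOn_id
  | succ n ih => exact ih.comp hc hm

theorem mem_omega_iff : y ∈ omega f x ↔ MapClusterPt y atTop (fun n : ℕ => f^[n] x) := by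
  rw [omega, mem_omegaLimit_singleton_iff_mapClusterPt]

theorem isClosed_omega : IsClosed (omega f x) := isClosed_omegaLimit _ _ _

/-- A closed set containing a tail of the orbit of `x` contains `omega f x`. -/
theorem omega_subset_of_isClosed {S : Set ℝ} (hS : IsClosed S) {N : ℕ}
    (h : ∀ n ≥ N, f^[n] x ∈ S) : omega f x ⊆ S := by
  intro y hy
  rw [mem_omega_iff] at hy
  by_contra hyS
  obtain ⟨n, hn, hnS⟩ := ((hy.frequently (hS.isOpen_compl.mem_nhds hyS)).and_eventually
    (eventually_ge_atTop N)).exists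
  exact hn (h n hnS)

theorem omega_subset_phase (hm : MapsTo f phase phase) (hx : x ∈ phase) :
    omega f x ⊆ phase :=
  omega_subset_of_isClosed isClosed_Icc (N := 0) fun n _ => hm.iterate n hx

theorem image_omega (hc : ContinuousOn f phase) (hm : MapsTo f phase phase) (hx : x ∈ phase) :
    f '' omega f x = omega f x := by
  have hit : ∀ n, f^[n] x ∈ phase := fun n => hm.iterate n hx
  apply Subset.antisymm
  · rintro _ ⟨y, hy, rfl⟩
    have hyp := omega_subset_phase hm hx hy
    rw [mem_omega_iff, mapClusterPt_iff_ultrafilter] at hy ⊢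
    obtain ⟨U, hU, hUy⟩ := hy
    -- If the orbit tends to `y` along `U`, then shifting `U` by one makes it tend to `f y`.
    refine ⟨U.map Nat.succ, ?_, ?_⟩
    · exact (tendsto_add_atTop_nat 1).mono_left hU
    · change Tendsto _ (map Nat.succ (U : Filter ℕ)) _
      rw [tendsto_map'_iff]
      have h1 : Tendsto (fun n => f^[n] x) U (𝓝[phase] y) :=
        tendsto_nhdsWithin_iff.2 ⟨hUy, Eventually.of_forall hit⟩
      refine ((hc y hyp).tendsto.comp h1).congr fun n => ?_
      simp only [comp_apply, Nat.succ_eq_add_one, iterate_succ_apply']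
  · intro y hy
    rw [mem_omega_iff, mapClusterPt_iff_ultrafilter] at hy
    obtain ⟨U, hU, hUy⟩ := hy
    -- A preimage of `y` is a limit of the preceding orbit points along the same ultrafilter; it
    -- exists by compactness. The truncation `0 - 1 = 0` is harmless because `U` contains all tails.
    have hV : Tendsto (fun n : ℕ => n - 1) U atTop := (tendsto_sub_atTop_nat 1).mono_left hU
    obtain ⟨z, hz, hUz⟩ := (isCompact_Icc (a := (0 : ℝ)) (b := 1)).ultrafilter_le_nhds
      (U.map fun n : ℕ => f^[n - 1] x) (by
        rw [le_principal_iff]; exact univ_mem' (f := (U : Filter ℕ)) fun n => hit (n - 1))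
    refine ⟨z, ?_, ?_⟩
    · rw [mem_omega_iff, mapClusterPt_iff_ultrafilter]
      refine ⟨U.map fun n : ℕ => n - 1, hV, ?_⟩
      change Tendsto _ (map _ (U : Filter ℕ)) _
      rw [tendsto_map'_iff]
      exact hUz
    · have h1 : Tendsto (fun n : ℕ => f^[n - 1] x) U (𝓝[phase] z) :=
        tendsto_nhdsWithin_iff.2 ⟨hUz, Eventually.of_forall fun n => hit (n - 1)⟩
      have h2 := (hc z hz).tendsto.comp h1
      refine tendsto_nhds_unique (h2.congr' ?_) hUy
      filter_upwards [hU (eventually_ge_atTop 1)] with n hn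
      simp only [comp_apply]
      rw [← iterate_succ_apply' f, Nat.succ_eq_add_one, Nat.sub_add_cancel hn]

theorem mapsTo_omega (hc : ContinuousOn f phase) (hm : MapsTo f phase phase) (hx : x ∈ phase) :
    MapsTo f (omega f x) (omega f x) :=
  mapsTo_iff_image_subset.2 (image_omega hc hm hx).subset

theorem omega_subset_of_mem {Y : Set ℝ} (hY : IsClosed Y) (hm : MapsTo f Y Y) (hx : x ∈ Y) :
    omega f x ⊆ Y :=
  omega_subset_of_isClosed hY (N := 0) fun n _ => hm.iterate n hx

/-- The forward orbit of a preperiodic point is finite. -/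
theorem finite_range_iterate {k m : ℕ} (hm : 1 ≤ m) (h : f^[m] (f^[k] x) = f^[k] x) :
    (range fun n : ℕ => f^[n] x).Finite := by
  refine ((Set.finite_lt_nat (k + m)).image fun n => f^[n] x).subset ?_
  rintro _ ⟨n, rfl⟩
  rcases lt_or_ge n (k + m) with hn | hn
  · exact ⟨n, hn, rfl⟩
  · refine ⟨k + (n - k) % m, ?_, ?_⟩
    · have := Nat.mod_lt (n - k) (by omega : 0 < m)
      simp only [mem_ofPred_eq]; omega
    · have h1 : IsPeriodicPt f m (f^[k] x) := h
      have h2 := h1.iterate_mod_apply (n - k)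
      rw [← iterate_add_apply, ← iterate_add_apply] at h2
      change f^[k + (n - k) % m] x = f^[n] x
      rw [Nat.add_comm, h2]
      congr 2; omega

/-- The orbit of a recurrent point that is not periodic has no repetitions. -/
theorem injective_orbit (hr : IsRecurrent f x) (hp : ∀ n, 1 ≤ n → f^[n] x ≠ x) :
    Injective fun n : ℕ => f^[n] x := by
  have key : ∀ k m : ℕ, 1 ≤ m → f^[m] (f^[k] x) ≠ f^[k] x := by
    intro k m hm h
    have hfin := finite_range_iterate hm h
    -- The orbit from time `1` on is finite, hence closed, so recurrence puts `x` itself in it.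
    have hS : ((fun n : ℕ => f^[n] x) '' Ici 1).Finite := hfin.subset (image_subset_range _ _)
    obtain ⟨n, hn, hnx⟩ := omega_subset_of_isClosed hS.isClosed (N := 1)
      (fun n hn => ⟨n, hn, rfl⟩) hr
    exact hp n hn hnx
  intro i j hij
  simp only at hij
  by_contra hne
  rcases lt_or_gt_of_ne hne with h | h
  · apply key i (j - i) (by omega)
    rw [← iterate_add_apply, Nat.sub_add_cancel h.le, hij]
  · apply key j (i - j) (by omega)
    rw [← iterate_add_apply, Nat.sub_add_cancel h.le, hij]

theorem iterate_mem_omega (hc : ContinuousOn f phase) (hm : MapsTo f phase phase)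
    (hx : x ∈ phase) (hr : IsRecurrent f x) (n : ℕ) : f^[n] x ∈ omega f x :=
  (mapsTo_omega hc hm hx).iterate n hr

/-- The orbit visits any neighbourhood of `y` at two different times, and by injectivity at most one
of the two points equals `y`. -/
theorem perfect_omega (hc : ContinuousOn f phase) (hm : MapsTo f phase phase)
    (hx : x ∈ phase) (hr : IsRecurrent f x) (hi : Injective fun n : ℕ => f^[n] x) :
    Perfect (omega f x) := by
  refine ⟨isClosed_omega, fun y hy => accPt_iff_nhds.2 fun U hU => ?_⟩
  rw [mem_omega_iff] at hy
  have h := hy.frequently hU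
  rw [frequently_atTop] at h
  obtain ⟨i, -, hi'⟩ := h 0
  obtain ⟨j, hj, hj'⟩ := h (i + 1)
  by_cases hiy : f^[i] x = y
  · refine ⟨_, ⟨hj', iterate_mem_omega hc hm hx hr j⟩, fun h => ?_⟩
    have := hi (hiy.trans h.symm)
    omega
  · exact ⟨_, ⟨hi', iterate_mem_omega hc hm hx hr i⟩, hiy⟩

/-- A minimal `ω`-limit set of a recurrent non-periodic point contains no interval. -/
theorem isTotallyDisconnected_omega (hc : ContinuousOn f phase) (hm : MapsTo f phase phase)
    (hx : x ∈ phase) (hr : IsRecurrent f x) (hi : Injective fun n : ℕ => f^[n] x)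
    (hmin : IsMinimalSet f (omega f x)) : IsTotallyDisconnected (omega f x) := by
  intro t ht htc
  by_contra hnt
  rw [Set.not_subsingleton_iff] at hnt
  obtain ⟨a, ha, b, hb, hab⟩ := hnt.exists_lt
  have hIcc : Icc a b ⊆ omega f x := (htc.Icc_subset ha hb).trans ht
  set K := connectedComponentIn (omega f x) a with hK
  have haΩ : a ∈ omega f x := hIcc ⟨le_rfl, hab.le⟩
  have hKΩ : K ⊆ omega f x := connectedComponentIn_subset _ _
  have hKc : IsPreconnected K := isPreconnected_connectedComponentIn
  have hIK : Icc a b ⊆ K :=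
    isPreconnected_Icc.subset_connectedComponentIn ⟨le_rfl, hab.le⟩ hIcc
  have hKcl : IsClosed K := by
    rw [← closure_subset_iff_isClosed]
    exact hKc.closure.subset_connectedComponentIn (subset_closure (hIK ⟨le_rfl, hab.le⟩))
      (closure_minimal hKΩ isClosed_omega)
  have hΩp := omega_subset_phase hm hx
  have hKcomp : IsCompact K := isCompact_Icc.of_isClosed_subset hKcl (hKΩ.trans hΩp)
  have hmid : (a + b) / 2 ∈ omega f x := hIcc ⟨by linarith, by linarith⟩
  rw [mem_omega_iff] at hmid
  have hfr := hmid.frequently (Ioo_mem_nhds (a := a) (b := b) (by linarith) (by linarith))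
  rw [frequently_atTop] at hfr
  obtain ⟨i, -, hi'⟩ := hfr 0
  obtain ⟨j, hj, hj'⟩ := hfr (i + 1)
  -- The orbit visits `K` at times `i < j`, so the image of the component `K` is a connected part of
  -- the limit set that meets `K`, hence lies in it.
  have hmaps : MapsTo f^[j - i] K K := by
    rw [mapsTo_iff_image_subset]
    have h1 : f^[j - i] '' K ⊆ omega f x :=
      (image_mono hKΩ).trans ((mapsTo_omega hc hm hx).iterate (j - i)).image_subset
    have h2 : IsPreconnected (f^[j - i] '' K) :=
      hKc.image _ ((continuousOn_iterate_phase hc hm _).mono (hKΩ.trans hΩp))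
    have h3 : f^[j] x ∈ K := hIK (Ioo_subset_Icc_self hj')
    have h4 : f^[j] x ∈ f^[j - i] '' K := by
      refine ⟨f^[i] x, hIK (Ioo_subset_Icc_self hi'), ?_⟩
      rw [← iterate_add_apply, Nat.sub_add_cancel (by omega)]
    have h5 := h2.subset_connectedComponentIn h4 h1
    rwa [← connectedComponentIn_eq h3] at h5
  have hKI := eq_Icc_of_connected_compact ⟨⟨a, hIK ⟨le_rfl, hab.le⟩⟩, hKc⟩ hKcomp
  have hle : sInf K ≤ sSup K := by
    have : a ∈ Icc (sInf K) (sSup K) := hKI ▸ hIK ⟨le_rfl, hab.le⟩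
    exact this.1.trans this.2
  obtain ⟨q, hq, hfq⟩ := exists_mem_Icc_isFixedPt_of_mapsTo
    ((continuousOn_iterate_phase hc hm (j - i)).mono (hKI ▸ hKΩ.trans hΩp)) hle
    (by rw [← hKI]; exact hmaps)
  rw [← hKI] at hq
  have hfin : (range fun n : ℕ => f^[n] q).Finite :=
    finite_range_iterate (k := 0) (m := j - i) (by omega) hfq
  -- The fixed point of `f^[j - i]` in the interval `K` has a finite orbit, which minimality
  -- identifies with the infinite limit set.
  have hY := hmin.eq_of_subset (range fun n : ℕ => f^[n] q)
    (by rintro _ ⟨n, rfl⟩; exact (mapsTo_omega hc hm hx).iterate n (hKΩ hq))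
    ⟨_, 0, rfl⟩ hfin.isClosed
    (by rintro _ ⟨n, rfl⟩; exact ⟨n + 1, iterate_succ_apply' f n q⟩)
  rw [hY] at hfin
  refine infinite_range_of_injective hi (hfin.subset ?_)
  rintro _ ⟨n, rfl⟩
  exact iterate_mem_omega hc hm hx hr n

end Omega

/-! ### Turning points are critical and not periodic. -/

section Turning

variable {f : ℝ → ℝ} {x : ℝ}

/-- A critical point is not periodic if all cycles are repelling. -/
theorem iterate_ne_of_hasDerivAt_zero (hd : DifferentiableOn ℝ f phase)
    (hm : MapsTo f phase phase) (hr : AllCyclesRepelling f) (hx : x ∈ phase)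
    (hz : HasDerivWithinAt f 0 phase x) {n : ℕ} (hn : 1 ≤ n) : f^[n] x ≠ x := by
  intro h
  have hdi : ∀ m, DifferentiableOn ℝ f^[m] phase := by
    intro m
    induction m with
    | zero => exact differentiableOn_id
    | succ m ih => exact ih.comp hd hm
  obtain ⟨m, rfl⟩ : ∃ m, n = m + 1 := ⟨n - 1, by omega⟩
  have h1 : HasDerivWithinAt (f^[m] ∘ f) _ phase x :=
    (hdi m (f x) (hm hx)).hasDerivWithinAt.comp x hz hm
  have h2 := hr x hx (m + 1) hn h
  rw [iterate_succ, h1.derivWithin (uniqueDiffOn_Icc zero_lt_one x hx)] at h2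
  norm_num at h2

/-- The alternating laps make `c` and `d` interior local extrema, so Fermat's theorem applies. -/
theorem ClassB.hasDerivWithinAt_turning {c d : ℝ} (h : ClassB f c d) :
    HasDerivWithinAt f 0 phase c ∧ HasDerivWithinAt f 0 phase d := by
  have hb := h.bimodal
  have h0 := hb.zero_lt
  have h1 := hb.lt
  have h2 := hb.lt_one
  have hdiff : ∀ x ∈ Ioo (0 : ℝ) 1, IsLocalExtr f x → HasDerivWithinAt f 0 phase x := by
    intro x hx he
    have hda : DifferentiableAt ℝ f x :=
      (h.contDiffOn.differentiableOn (by norm_num)).differentiableAt (Icc_mem_nhds hx.1 hx.2)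
    have := hda.hasDerivAt
    rw [he.deriv_eq_zero] at this
    exact this.hasDerivWithinAt
  have hcn : ∀ᶠ y in 𝓝 c, y ∈ Ioo 0 d := Ioo_mem_nhds h0 h1
  have hdn : ∀ᶠ y in 𝓝 d, y ∈ Ioo c 1 := Ioo_mem_nhds h1 h2
  rcases hb.laps with ⟨a1, a2, a3⟩ | ⟨a1, a2, a3⟩
  · refine ⟨hdiff c ⟨h0, h1.trans h2⟩ (Or.inr ?_), hdiff d ⟨h0.trans h1, h2⟩ (Or.inl ?_)⟩
    · filter_upwards [hcn] with y hy
      rcases le_total y c with hyc | hyc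
      · exact a1.monotoneOn ⟨hy.1.le, hyc⟩ ⟨h0.le, le_rfl⟩ hyc
      · exact a2.antitoneOn ⟨le_rfl, h1.le⟩ ⟨hyc, hy.2.le⟩ hyc
    · filter_upwards [hdn] with y hy
      rcases le_total y d with hyc | hyc
      · exact a2.antitoneOn ⟨hy.1.le, hyc⟩ ⟨h1.le, le_rfl⟩ hyc
      · exact a3.monotoneOn ⟨le_rfl, h2.le⟩ ⟨hyc, hy.2.le⟩ hyc
  · refine ⟨hdiff c ⟨h0, h1.trans h2⟩ (Or.inl ?_), hdiff d ⟨h0.trans h1, h2⟩ (Or.inr ?_)⟩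
    · filter_upwards [hcn] with y hy
      rcases le_total y c with hyc | hyc
      · exact a1.antitoneOn ⟨hy.1.le, hyc⟩ ⟨h0.le, le_rfl⟩ hyc
      · exact a2.monotoneOn ⟨le_rfl, h1.le⟩ ⟨hyc, hy.2.le⟩ hyc
    · filter_upwards [hdn] with y hy
      rcases le_total y d with hyc | hyc
      · exact a2.monotoneOn ⟨hy.1.le, hyc⟩ ⟨h1.le, le_rfl⟩ hyc
      · exact a3.antitoneOn ⟨le_rfl, h2.le⟩ ⟨hyc, hy.2.le⟩ hyc

end Turning

/-! ### Entry times into nice sets, shrinking components and bounded returns. -/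

section Entry

variable {f : ℝ → ℝ} {T : Set ℝ} {x : ℝ}

theorem entryTime_spec (hx : x ∈ entryDomain f T) :
    1 ≤ entryTime f T x ∧ f^[entryTime f T x] x ∈ T :=
  Nat.sInf_mem (s := {k : ℕ | 1 ≤ k ∧ f^[k] x ∈ T}) hx.2

theorem entryTime_le {k : ℕ} (hk : 1 ≤ k) (h : f^[k] x ∈ T) : entryTime f T x ≤ k :=
  Nat.sInf_le (s := {k : ℕ | 1 ≤ k ∧ f^[k] x ∈ T}) ⟨hk, h⟩

theorem entryDomain_mono {S : Set ℝ} (h : S ⊆ T) : entryDomain f S ⊆ entryDomain f T :=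
  fun _ ⟨hx, k, hk, hkx⟩ => ⟨hx, k, hk, h hkx⟩

theorem mem_entryDomain_of_isRecurrent (hx : x ∈ phase) (hr : IsRecurrent f x) (hT : IsOpen T)
    (hxT : x ∈ T) : x ∈ entryDomain f T := by
  rw [IsRecurrent, mem_omega_iff] at hr
  obtain ⟨k, hk, hkT⟩ := (frequently_atTop.1 (hr.frequently (hT.mem_nhds hxT))) 1
  exact ⟨hx, k, hk, hkT⟩

/-- An open subset of `(0, 1)` whose boundary points never enter it. -/
structure IsNice (f : ℝ → ℝ) (T : Set ℝ) : Prop where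
  isOpen : IsOpen T
  subset_Ioo : T ⊆ Ioo 0 1
  iterate_notMem : ∀ z ∈ closure T, z ∉ T → ∀ k : ℕ, f^[k] z ∉ T

/-- Continuity into `ℕ` means local constancy. Entering the open set `T` at a given time is an open
condition. Iterates before the entry time avoid even `closure T`, since a boundary point of a nice
set never enters it, so nearby points do not enter earlier. -/
theorem IsNice.continuousOn_entryTime (hT : IsNice f T) (hc : ContinuousOn f phase)
    (hm : MapsTo f phase phase) : ContinuousOn (entryTime f T) (entryDomain f T) := by
  intro x hx
  obtain ⟨h1, h2⟩ := entryTime_spec hx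
  have hcont : ∀ k, ContinuousWithinAt f^[k] (entryDomain f T) x := fun k =>
    (continuousOn_iterate_phase hc hm k x hx.1).mono fun y hy => hy.1
  have hT' : ∀ᶠ y in 𝓝[entryDomain f T] x, f^[entryTime f T x] y ∈ T :=
    (hcont _).eventually (hT.isOpen.mem_nhds h2)
  have hlt : ∀ᶠ y in 𝓝[entryDomain f T] x,
      ∀ i ∈ Finset.Ico 1 (entryTime f T x), f^[i] y ∉ T := by
    rw [Filter.eventually_all_finset]
    intro i hi
    rw [Finset.mem_Ico] at hi
    have hiT : f^[i] x ∉ T := fun h => hi.2.not_ge (entryTime_le hi.1 h)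
    have hicl : f^[i] x ∉ closure T := by
      intro h
      apply hT.iterate_notMem _ h hiT (entryTime f T x - i)
      rw [← iterate_add_apply, Nat.sub_add_cancel hi.2.le]
      exact h2
    filter_upwards [(hcont i).eventually (isClosed_closure.isOpen_compl.mem_nhds hicl)] with y hy
    exact fun h => hy (subset_closure h)
  refine tendsto_nhds_of_eventually_eq ?_
  filter_upwards [hT', hlt, self_mem_nhdsWithin] with y hy hy' hyD
  obtain ⟨h3, h4⟩ := entryTime_spec hyD
  refine le_antisymm (entryTime_le h1 hy) (not_lt.1 fun h => ?_)
  exact hy' _ (Finset.mem_Ico.2 ⟨h3, h⟩) h4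

theorem IsNice.entryTime_eq (hT : IsNice f T) (hc : ContinuousOn f phase)
    (hm : MapsTo f phase phase) {K : Set ℝ} (hK : IsPreconnected K) (hKD : K ⊆ entryDomain f T)
    {y z : ℝ} (hy : y ∈ K) (hz : z ∈ K) : entryTime f T y = entryTime f T z :=
  hK.constant ((hT.continuousOn_entryTime hc hm).mono hKD) hy hz

theorem IsNice.exists_entryTime_le (hT : IsNice f T) (hc : ContinuousOn f phase)
    (hm : MapsTo f phase phase) {K : Set ℝ} (hK : IsPreconnected K)
    (hKD : K ⊆ entryDomain f T) : ∃ N, ∀ y ∈ K, entryTime f T y ≤ N := by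
  rcases K.eq_empty_or_nonempty with rfl | ⟨z, hz⟩
  · exact ⟨0, by simp⟩
  · exact ⟨entryTime f T z, fun y hy => (hT.entryTime_eq hc hm hK hKD hy hz).le⟩

/-- The end points stay in `{0, 1}` forever and so never enter `T`. -/
theorem entryDomain_subset_Ioo (hends : f '' {0, 1} = {0, 1}) (hT : T ⊆ Ioo 0 1) :
    entryDomain f T ⊆ Ioo 0 1 := by
  rintro x ⟨hx, k, -, hk⟩
  have hmaps : MapsTo f {0, 1} ({0, 1} : Set ℝ) := mapsTo_iff_image_subset.2 hends.subset
  have hne : x ∉ ({0, 1} : Set ℝ) := by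
    intro h
    have h1 := hT hk
    rcases hmaps.iterate k h with h2 | h2
    · exact h1.1.ne' h2
    · exact h1.2.ne h2
  simp only [mem_insert_iff, mem_singleton_iff, not_or] at hne
  exact ⟨lt_of_le_of_ne hx.1 (Ne.symm hne.1), lt_of_le_of_ne hx.2 hne.2⟩

theorem IsNice.isOpen_entryDomain (hT : IsNice f T) (hc : ContinuousOn f phase)
    (hm : MapsTo f phase phase) (hends : f '' {0, 1} = {0, 1}) : IsOpen (entryDomain f T) := by
  rw [isOpen_iff_mem_nhds]
  intro x hx
  have hx01 := entryDomain_subset_Ioo hends hT.subset_Ioo hx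
  obtain ⟨-, k, hk, hkT⟩ := hx
  have ho : IsOpen (Ioo 0 1 ∩ f^[k] ⁻¹' T) :=
    ((continuousOn_iterate_phase hc hm k).mono Ioo_subset_Icc_self).isOpen_inter_preimage
      isOpen_Ioo hT.isOpen
  filter_upwards [ho.mem_nhds ⟨hx01, hkT⟩] with y hy
  exact ⟨Ioo_subset_Icc_self hy.1, k, hk, hy.2⟩

/-- Adjoining a closure point keeps the component connected, so a closure point in the domain would
contradict maximality. -/
theorem notMem_entryDomain_of_mem_closure {z : ℝ} (hz : z ∈ closure (entryComponent f T x))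
    (hzn : z ∉ entryComponent f T x) : z ∉ entryDomain f T := by
  intro hD
  have hx : x ∈ entryDomain f T := by
    rw [← connectedComponentIn_nonempty_iff, ← closure_nonempty_iff]
    exact ⟨z, hz⟩
  have h1 : IsPreconnected (insert z (entryComponent f T x)) :=
    isPreconnected_connectedComponentIn.subset_closure (subset_insert _ _)
      (insert_subset hz subset_closure)
  exact hzn (h1.subset_connectedComponentIn (Or.inr (mem_connectedComponentIn hx))
    (insert_subset hD (connectedComponentIn_subset _ _)) (mem_insert _ _))

theorem IsNice.entryComponent_union (hT : IsNice f T) (hc : ContinuousOn f phase)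
    (hm : MapsTo f phase phase) (hends : f '' {0, 1} = {0, 1}) {c d : ℝ}
    (hsub : entryComponent f T c ∪ entryComponent f T d ⊆ T) :
    IsNice f (entryComponent f T c ∪ entryComponent f T d) := by
  have ho := hT.isOpen_entryDomain hc hm hends
  refine ⟨ho.connectedComponentIn.union ho.connectedComponentIn, hsub.trans hT.subset_Ioo, ?_⟩
  intro z hz hzn k hk
  have hzp : z ∈ phase :=
    closure_minimal ((hsub.trans hT.subset_Ioo).trans Ioo_subset_Icc_self) isClosed_Icc hz
  rcases Nat.eq_zero_or_pos k with rfl | hk0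
  · exact hzn hk
  have hD : z ∈ entryDomain f T := ⟨hzp, k, hk0, hsub hk⟩
  rw [closure_union] at hz
  rcases hz with hz | hz
  · exact notMem_entryDomain_of_mem_closure hz (fun h => hzn (Or.inl h)) hD
  · exact notMem_entryDomain_of_mem_closure hz (fun h => hzn (Or.inr h)) hD

/-- All three boundary points map to the fixed point `p`, which is itself one of them and lies
outside the open intervals. -/
theorem IsStartingPair.isNice {c d : ℝ} {I₀ J₀ : Set ℝ} (h : IsStartingPair f c d I₀ J₀) :
    IsNice f (I₀ ∪ J₀) := by
  obtain ⟨p, hp, p₁, hp₁, p₂, hp₂, h0, h1, h2, h⟩ := h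
  have key : ∀ a b e : ℝ, a < b → b < e → a ∈ phase → e ∈ phase → f a = p → f b = p → f e = p →
      p = a ∨ p = b ∨ p = e → IsNice f (Ioo a b ∪ Ioo b e) := by
    intro a b e hab hbe ha he hfa hfb hfe hpp
    have hpn : p ∉ Ioo a b ∪ Ioo b e := by
      rintro (⟨h3, h4⟩ | ⟨h3, h4⟩) <;> rcases hpp with h5 | h5 | h5 <;> linarith
    refine ⟨isOpen_Ioo.union isOpen_Ioo, union_subset ?_ ?_, ?_⟩
    · exact fun y hy => ⟨ha.1.trans_lt hy.1, hy.2.trans (hbe.trans_le he.2)⟩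
    · exact fun y hy => ⟨(ha.1.trans_lt hab).trans hy.1, hy.2.trans_le he.2⟩
    · intro z hz hzn k hk
      have hfz : f z = p := by
        rw [closure_union, closure_Ioo hab.ne, closure_Ioo hbe.ne] at hz
        have : z = a ∨ z = b ∨ z = e := by
          by_contra! hne
          obtain ⟨n1, n2, n3⟩ := hne
          apply hzn
          rcases hz with hz | hz
          · exact Or.inl ⟨lt_of_le_of_ne hz.1 n1.symm, lt_of_le_of_ne hz.2 n2⟩
          · exact Or.inr ⟨lt_of_le_of_ne hz.1 n2.symm, lt_of_le_of_ne hz.2 n3⟩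
        rcases this with rfl | rfl | rfl <;> assumption
      rcases k with _ | k
      · exact hzn hk
      · rw [iterate_succ_apply, hfz, iterate_fixed h0] at hk
        exact hpn hk
  rcases h with ⟨-, h3, h4, rfl, rfl⟩ | ⟨-, -, -, ⟨h3, h4, rfl, rfl⟩ | ⟨h3, h4, rfl, rfl⟩⟩
  · exact key _ _ _ h3 h4 hp₁ hp₂ h1 h0 h2 (by simp)
  · exact key _ _ _ h3 h4 hp hp₂ h0 h1 h2 (by simp)
  · exact key _ _ _ h3 h4 hp₁ hp h1 h2 h0 (by simp)

/-- If the entry times of a recurrent non-periodic point `e` into a sequence of nice sets grow,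
then, in the absence of wandering intervals, the entry components of `e` have only `e` in
common. -/
theorem iInter_entryComponent_subset {e : ℝ} (hc : ContinuousOn f phase)
    (hm : MapsTo f phase phase) (hr : IsRecurrent f e) (hi : Injective fun n : ℕ => f^[n] e)
    (hw : ¬ ∃ W : Set ℝ, IsWanderingInterval f W) {L : ℕ → Set ℝ} (hL : ∀ n, IsNice f (L n))
    (he : ∀ n, e ∈ entryDomain f (L n))
    (hs : StrictMono fun n => entryTime f (L n) e) :
    ⋂ n, entryComponent f (L n) e ⊆ {e} := by
  intro x hx
  by_contra hxe
  set W := ⋂ n, entryComponent f (L n) e with hWdef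
  have hWD : ∀ n, W ⊆ entryDomain f (L n) := fun n =>
    (iInter_subset _ n).trans (connectedComponentIn_subset _ _)
  have heW : e ∈ W := mem_iInter.2 fun n => mem_connectedComponentIn (he n)
  have htime : ∀ n, ∀ y ∈ W, entryTime f (L n) y = entryTime f (L n) e := fun n y hy =>
    (hL n).entryTime_eq hc hm isPreconnected_connectedComponentIn
      (connectedComponentIn_subset _ _) (mem_iInter.1 hy n) (mem_iInter.1 heW n)
  have hdisj : ∀ i j : ℕ, i < j → Disjoint (f^[i] '' W) (f^[j] '' W) := by
    intro i j hij
    rw [Set.disjoint_left]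
    rintro _ ⟨y, hy, rfl⟩ ⟨z, hz, hzy⟩
    -- A strictly increasing sequence of naturals dominates its index, so at level `j + 1` the entry
    -- time exceeds `j`.
    have hn := hs.id_le (j + 1)
    simp only [id] at hn
    set n := j + 1
    have hty := htime n y hy
    have htz := htime n z hz
    have h1 := (entryTime_spec (hWD n hz)).2
    have h2 : f^[entryTime f (L n) z - j] (f^[j] z) ∈ L n := by
      rw [← iterate_add_apply, Nat.sub_add_cancel (by omega)]; exact h1
    rw [hzy, ← iterate_add_apply] at h2
    -- With `t` the common entry time, the coincidence lets `y` enter at time `t - j + i`, which is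
    -- smaller than `t`.
    have := entryTime_le (by omega) h2
    omega
  refine hw ⟨W, fun y hy => (hWD 0 hy).1, ordConnected_iInter fun n =>
    isPreconnected_connectedComponentIn.ordConnected, ⟨x, hx, e, heW, hxe⟩, ?_, ?_⟩
  · intro i j hij
    rcases lt_or_gt_of_ne hij with h | h
    · exact hdisj i j h
    · exact (hdisj j i h).symm
  -- The recurrent point `e` lies in the limit set of `W`; were this a periodic orbit, `e` would be
  -- periodic.
  · rintro ⟨q, -, ⟨m, hm1, hq⟩, hωW⟩
    have h1 : e ∈ omegaLimit atTop (fun n : ℕ => f^[n]) W :=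
      omegaLimit_mono_right _ _ (singleton_subset_iff.2 heW) hr
    rw [hωW] at h1
    obtain ⟨n, hn⟩ := h1
    have h2 : f^[m] e = e := by
      simp only at hn
      rw [← hn, ← iterate_add_apply, Nat.add_comm, iterate_add_apply, hq]
    have := hi (a₁ := m) (a₂ := 0) h2
    omega

/-- If points of `omega f x` in `T` return to `T` in bounded time, then the orbit of
every point of `omega f x` meets the closure of `T`. -/
theorem exists_iterate_mem_closure (hc : ContinuousOn f phase) (hm : MapsTo f phase phase)
    (hx : x ∈ phase) (hr : IsRecurrent f x) (hxT : x ∈ T) {N : ℕ}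
    (hN : ∀ y ∈ omega f x ∩ T, ∃ k, 1 ≤ k ∧ k ≤ N ∧ f^[k] y ∈ T) {y : ℝ}
    (hy : y ∈ omega f x) : ∃ j, f^[j] y ∈ closure T := by
  -- Every window of `N + 1` consecutive times contains a visit of the orbit of `x` to `T`.
  have hgap : ∀ n, ∃ j ≤ N, f^[j + n] x ∈ T := by
    intro n
    induction n with
    | zero => exact ⟨0, Nat.zero_le _, hxT⟩
    | succ n ih =>
      obtain ⟨j, hj, hjT⟩ := ih
      rcases j with _ | j
      · obtain ⟨k, h1, h2, h3⟩ := hN _ ⟨iterate_mem_omega hc hm hx hr _, hjT⟩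
        refine ⟨k - 1, by omega, ?_⟩
        rw [← iterate_add_apply] at h3
        rwa [show k - 1 + (n + 1) = k + (0 + n) by omega]
      · refine ⟨j, by omega, ?_⟩
        rwa [show j + (n + 1) = j + 1 + n by omega]
  -- A finite union of closed sets containing the whole orbit of `x`, hence its limit set; this is
  -- where the uniform bound `N` is needed.
  set S := ⋃ j ∈ Finset.range (N + 1), phase ∩ f^[j] ⁻¹' closure T with hS
  have hScl : IsClosed S := by
    refine isClosed_biUnion_finset fun j _ => ?_
    exact (continuousOn_iterate_phase hc hm j).preimage_isClosed_of_isClosed isClosed_Icc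
      isClosed_closure
  have hyS : y ∈ S := by
    refine omega_subset_of_isClosed hScl (N := 0) (fun n _ => ?_) hy
    obtain ⟨j, hj, hjT⟩ := hgap n
    refine mem_biUnion (x := j) (Finset.mem_coe.2 (Finset.mem_range.2 (by omega)))
      ⟨hm.iterate n hx, ?_⟩
    rw [mem_preimage, ← iterate_add_apply]
    exact subset_closure hjT
  rw [hS, mem_iUnion₂] at hyS
  obtain ⟨j, -, hj⟩ := hyS
  exact ⟨j, hj.2⟩

/-- If intervals have only the point `e` in common, then so have their closures. -/
theorem eq_of_mem_closure {K : ℕ → Set ℝ} {e y : ℝ} (hK : ∀ n, IsPreconnected (K n))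
    (he : ∀ n, e ∈ K n) (hKe : ⋂ n, K n ⊆ {e}) (hy : ∀ n, y ∈ closure (K n)) : y = e := by
  by_contra hne
  have hmid : (y + e) / 2 ∈ ⋂ n, K n := by
    refine mem_iInter.2 fun n => ?_
    have hsub := (hK n).ordConnected
    rcases lt_or_gt_of_ne hne with h | h
    · obtain ⟨z, hz, hzK⟩ := mem_closure_iff.1 (hy n) (Iio ((y + e) / 2)) isOpen_Iio
        (by simp only [mem_Iio]; linarith)
      exact hsub.out hzK (he n) ⟨(mem_Iio.1 hz).le, by linarith⟩
    · obtain ⟨z, hz, hzK⟩ := mem_closure_iff.1 (hy n) (Ioi ((y + e) / 2)) isOpen_Ioi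
        (by simp only [mem_Ioi]; linarith)
      exact hsub.out (he n) hzK ⟨by linarith, (mem_Ioi.1 hz).le⟩
  have := mem_singleton_iff.1 (hKe hmid)
  apply hne
  linarith

end Entry

/-! ### The twin principal nest and minimality of the limit set. -/

section Nest

variable {f : ℝ → ℝ} {c d : ℝ} {I₀ J₀ : Set ℝ} {C D : ℕ → Set ℝ}

theorem level_two_add (n : ℕ) : level f c d I₀ J₀ (n + 2) =
    entryComponent f (level f c d I₀ J₀ (n + 1)) c ∪
      entryComponent f (level f c d I₀ J₀ (n + 1)) d := rfl

namespace IsGeneralizedFibonacci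

/-- By the high return condition, each point of the deeper level is a value of the first return map
to the shallower one. -/
theorem level_succ_subset (h : IsGeneralizedFibonacci f c d I₀ J₀ C D) (n : ℕ) :
    level f c d I₀ J₀ (n + 2) ⊆ level f c d I₀ J₀ (n + 1) := by
  intro y hy
  obtain ⟨x, hx, rfl⟩ := h.high_return n hy
  have hxD : x ∈ entryDomain f (level f c d I₀ J₀ (n + 1)) := by
    rcases hx with hx | hx <;> exact connectedComponentIn_subset _ _ hx
  exact (entryTime_spec hxD).2

theorem isNice_level (h : IsGeneralizedFibonacci f c d I₀ J₀ C D) (hb : IsBimodal f c d)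
    (n : ℕ) : IsNice f (level f c d I₀ J₀ (n + 1)) := by
  induction n with
  | zero => exact h.starting.isNice
  | succ n ih =>
    exact ih.entryComponent_union hb.continuousOn hb.mapsTo hb.image_ends (h.level_succ_subset n)

theorem mem_entryDomain (h : IsGeneralizedFibonacci f c d I₀ J₀ C D) (hb : IsBimodal f c d)
    (hrc : IsRecurrent f c) (hrd : IsRecurrent f d) (n : ℕ) :
    c ∈ entryDomain f (level f c d I₀ J₀ (n + 1)) ∧
      d ∈ entryDomain f (level f c d I₀ J₀ (n + 1)) := by
  have h0 := hb.zero_lt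
  have h1 := hb.lt
  have h2 := hb.lt_one
  have hcp : c ∈ phase := ⟨h0.le, (h1.trans h2).le⟩
  have hdp : d ∈ phase := ⟨(h0.trans h1).le, h2.le⟩
  induction n with
  | zero =>
    exact ⟨⟨hcp, 2, by omega, h.values_two.1⟩, ⟨hdp, 2, by omega, h.values_two.2⟩⟩
  | succ n ih =>
    have ho := (h.isNice_level hb (n + 1)).isOpen
    exact ⟨mem_entryDomain_of_isRecurrent hcp hrc ho (Or.inl (mem_connectedComponentIn ih.1)),
      mem_entryDomain_of_isRecurrent hdp hrd ho (Or.inr (mem_connectedComponentIn ih.2))⟩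

/-- Iterating the return map `j` times amounts to at least `j - 1` further iterations of `f`
after the first return. -/
theorem exists_iterate_returnMap {e : ℝ} {n r : ℕ}
    (hdom : ∀ i < r, (returnMap f c d I₀ J₀ n)^[i] e ∈ returnDom f c d I₀ J₀ n) {j : ℕ}
    (hj : j + 1 ≤ r) : ∃ m, entryTime f (level f c d I₀ J₀ n) e + j ≤ m ∧
      (returnMap f c d I₀ J₀ n)^[j + 1] e = f^[m] e := by
  induction j with
  | zero => exact ⟨_, le_rfl, rfl⟩
  | succ j ih =>
    obtain ⟨m, hm, hme⟩ := ih (by omega)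
    have h1 := entryTime_spec (hdom (j + 1) (by omega)).1
    refine ⟨entryTime f (level f c d I₀ J₀ n) ((returnMap f c d I₀ J₀ n)^[j + 1] e) + m,
      by omega, ?_⟩
    rw [iterate_succ_apply' (returnMap f c d I₀ J₀ n) (j + 1), iterate_add_apply f, ← hme]
    rfl

/-- The next return is `r ≥ 2` steps of the current return map, which costs at least `r - 1` extra
iterations of `f`. Injectivity of the orbit turns equality of the points reached into equality of
times. -/
theorem strictMono_entryTime (h : IsGeneralizedFibonacci f c d I₀ J₀ C D) {e : ℝ}
    (hi : Injective fun n : ℕ => f^[n] e)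
    (he : ∀ n, e ∈ level f c d I₀ J₀ (n + 2)) :
    StrictMono fun n => entryTime f (level f c d I₀ J₀ (n + 2)) e := by
  refine strictMono_nat_of_lt_succ fun n => ?_
  obtain ⟨r, hr, hit⟩ := h.central_iterate (n + 2)
  obtain ⟨hdom, heq⟩ := hit e (he (n + 2))
  obtain ⟨m, hm, hme⟩ := exists_iterate_returnMap hdom (j := r - 1) (by omega)
  rw [Nat.sub_add_cancel (by omega), ← heq] at hme
  have : entryTime f (level f c d I₀ J₀ (n + 3)) e = m := hi hme
  change _ < entryTime f (level f c d I₀ J₀ (n + 3)) e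
  omega

/-- Points of the common `ω`-limit set in a level return to it in bounded time. -/
theorem exists_return_le (h : IsGeneralizedFibonacci f c d I₀ J₀ C D) (hb : IsBimodal f c d)
    (n : ℕ) : ∃ N, ∀ y ∈ omega f c ∩ level f c d I₀ J₀ (n + 1),
      ∃ k, 1 ≤ k ∧ k ≤ N ∧ f^[k] y ∈ level f c d I₀ J₀ (n + 1) := by
  set T := level f c d I₀ J₀ (n + 1) with hT
  have hcases : ∀ S : Set ℝ, (∃ x, S = returnComponent f T x) →
      IsPreconnected S ∧ S ⊆ entryDomain f T := by
    rintro _ ⟨x, rfl⟩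
    exact ⟨isPreconnected_connectedComponentIn,
      (connectedComponentIn_subset _ _).trans inter_subset_left⟩
  have hCD : (∃ x, C (n + 1) = returnComponent f T x) ∧
      ∃ x, D (n + 1) = returnComponent f T x := by
    rcases (h.valueDomains n).2.2 with ⟨h1, h2⟩ | ⟨h1, h2⟩ <;> exact ⟨⟨_, h1⟩, ⟨_, h2⟩⟩
  have hbd : ∀ S : Set ℝ, IsPreconnected S → S ⊆ entryDomain f T →
      ∃ N, ∀ y ∈ S, entryTime f T y ≤ N := fun S h1 h2 =>
    (h.isNice_level hb n).exists_entryTime_le hb.continuousOn hb.mapsTo h1 h2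
  have hsub : ∀ x, entryComponent f T x ⊆ entryDomain f T := fun x =>
    connectedComponentIn_subset _ _
  obtain ⟨hC1, hC2⟩ := hcases _ hCD.1
  obtain ⟨hD1, hD2⟩ := hcases _ hCD.2
  obtain ⟨N₁, h1⟩ := hbd (entryComponent f T c) isPreconnected_connectedComponentIn (hsub c)
  obtain ⟨N₂, h2⟩ := hbd (entryComponent f T d) isPreconnected_connectedComponentIn (hsub d)
  obtain ⟨N₃, h3⟩ := hbd _ hC1 hC2
  obtain ⟨N₄, h4⟩ := hbd _ hD1 hD2
  refine ⟨N₁ + N₂ + N₃ + N₄, fun y hy => ⟨entryTime f T y, ?_⟩⟩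
  rcases h.omega_subset n ⟨Or.inl hy.1, hy.2⟩ with ((hy' | hy') | hy') | hy'
  · have ⟨hk, hkT⟩ := entryTime_spec (hsub c hy')
    have := h1 y hy'
    exact ⟨hk, by omega, hkT⟩
  · have ⟨hk, hkT⟩ := entryTime_spec (hsub d hy')
    have := h2 y hy'
    exact ⟨hk, by omega, hkT⟩
  · have ⟨hk, hkT⟩ := entryTime_spec (hC2 hy')
    have := h3 y hy'
    exact ⟨hk, by omega, hkT⟩
  · have ⟨hk, hkT⟩ := entryTime_spec (hD2 hy')
    have := h4 y hy'
    exact ⟨hk, by omega, hkT⟩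

end IsGeneralizedFibonacci

theorem ClassBStar.injective_orbit (h : ClassBStar f c d) :
    (Injective fun n : ℕ => f^[n] c) ∧ Injective fun n : ℕ => f^[n] d := by
  have hb := h.classB.bimodal
  have h0 := hb.zero_lt
  have h1 := hb.lt
  have h2 := hb.lt_one
  have hd := h.classB.contDiffOn.differentiableOn (by norm_num)
  obtain ⟨hzc, hzd⟩ := h.classB.hasDerivWithinAt_turning
  exact ⟨Bimodal.injective_orbit h.recurrent_c fun n => iterate_ne_of_hasDerivAt_zero hd hb.mapsTo
      h.classB.repelling ⟨h0.le, (h1.trans h2).le⟩ hzc,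
    Bimodal.injective_orbit h.recurrent_d fun n => iterate_ne_of_hasDerivAt_zero hd hb.mapsTo
      h.classB.repelling ⟨(h0.trans h1).le, h2.le⟩ hzd⟩

theorem ClassG.isMinimalSet_omega (h : ClassG f c d) : IsMinimalSet f (omega f c) := by
  obtain ⟨hB, I₀, J₀, C, D, hG⟩ := h
  have hb := hB.classB.bimodal
  have hc := hb.continuousOn
  have hm := hb.mapsTo
  have h0 := hb.zero_lt
  have h1 := hb.lt
  have h2 := hb.lt_one
  have hcp : c ∈ phase := ⟨h0.le, (h1.trans h2).le⟩
  have hrc := hB.recurrent_c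
  have hrd := hB.recurrent_d
  obtain ⟨hic, hid⟩ := hB.injective_orbit
  have hdom := hG.mem_entryDomain hb hrc hrd
  -- From index `2` on, a level is the union of the components around `c` and `d`, so it contains
  -- both turning points by construction.
  set L : ℕ → Set ℝ := fun n => level f c d I₀ J₀ (n + 2) with hL
  have hLs : ∀ n, L (n + 1) ⊆ L n := fun n => hG.level_succ_subset (n + 1)
  have hnice : ∀ n, IsNice f (L n) := fun n => hG.isNice_level hb (n + 1)
  have hcL : ∀ n, c ∈ L n := fun n => Or.inl (mem_connectedComponentIn (hdom n).1)
  have hdL : ∀ n, d ∈ L n := fun n => Or.inr (mem_connectedComponentIn (hdom n).2)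
  have hKc := iInter_entryComponent_subset hc hm hrc hic hB.classB.no_wandering hnice
    (fun n => (hdom (n + 1)).1) (hG.strictMono_entryTime hic hcL)
  have hKd := iInter_entryComponent_subset hc hm hrd hid hB.classB.no_wandering hnice
    (fun n => (hdom (n + 1)).2) (hG.strictMono_entryTime hid hdL)
  have hanti : ∀ x, Antitone fun n => entryComponent f (L n) x := fun x =>
    antitone_nat_of_succ_le fun n => connectedComponentIn_mono _ (entryDomain_mono (hLs n))
  refine ⟨⟨c, hrc⟩, isClosed_omega, mapsTo_omega hc hm hcp, fun Y hYΩ hYne hYcl hYm => ?_⟩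
  have hmeet : ∀ n, (Y ∩ closure (L n)).Nonempty := by
    intro n
    obtain ⟨y, hy⟩ := hYne
    obtain ⟨N, hN⟩ := hG.exists_return_le hb (n + 1)
    obtain ⟨j, hj⟩ := exists_iterate_mem_closure hc hm hcp hrc (hcL n) hN (hYΩ hy)
    exact ⟨_, hYm.iterate j hy, hj⟩
  -- Cantor's intersection theorem yields a point of `Y` in the closure of every level.
  obtain ⟨y, hy⟩ := IsCompact.nonempty_iInter_of_sequence_nonempty_isCompact_isClosed
    (fun n => Y ∩ closure (L n)) (fun n => inter_subset_inter_right _ (closure_mono (hLs n))) hmeet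
    (isCompact_Icc.of_isClosed_subset (hYcl.inter isClosed_closure)
      (inter_subset_left.trans (hYΩ.trans (omega_subset_phase hm hcp))))
    (fun n => hYcl.inter isClosed_closure)
  rw [mem_iInter] at hy
  have hyY : y ∈ Y := (hy 0).1
  have hcl : ∀ n, y ∈ closure (entryComponent f (L n) c) ∨
      y ∈ closure (entryComponent f (L n) d) := by
    intro n
    have := (hy (n + 1)).2
    rwa [show L (n + 1) = _ from level_two_add (n + 1), closure_union] at this
  have hor : y = c ∨ y = d := by
    -- The components are nested: once `y` leaves the closures around `c` at stage `m`, it lies in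
    -- those around `d` at all stages from `m` on, hence at all stages.
    by_cases hcc : ∀ n, y ∈ closure (entryComponent f (L n) c)
    · exact Or.inl (eq_of_mem_closure (fun n => isPreconnected_connectedComponentIn)
        (fun n => mem_connectedComponentIn (hdom (n + 1)).1) hKc hcc)
    · push Not at hcc
      obtain ⟨m, hmc⟩ := hcc
      refine Or.inr (eq_of_mem_closure (fun n => isPreconnected_connectedComponentIn)
        (fun n => mem_connectedComponentIn (hdom (n + 1)).2) hKd fun n => ?_)
      have h3 : y ∈ closure (entryComponent f (L (max m n)) d) :=
        (hcl (max m n)).resolve_left fun h => hmc (closure_mono (hanti c (le_max_left m n)) h)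
      exact closure_mono (hanti d (le_max_right m n)) h3
  refine hYΩ.antisymm ?_
  rcases hor with rfl | rfl
  · exact omega_subset_of_mem hYcl hYm hyY
  · rw [hB.omega_eq]
    exact omega_subset_of_mem hYcl hYm hyY

end Nest

end Bimodal

theorem lemma2p7 (f : ℝ → ℝ) (c d : ℝ) (hf : Bimodal.ClassC f c d) :
    Bimodal.omega f c = Bimodal.omega f d ∧
    Bimodal.omega f c ⊆ Set.Icc 0 1 ∧
    f '' Bimodal.omega f c = Bimodal.omega f c ∧
    Bimodal.IsMinimalSet f (Bimodal.omega f c) ∧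
    Bimodal.IsCantorSet (Bimodal.omega f c) := by
  obtain ⟨hG, -⟩ := hf
  have hB := hG.1
  have hb := hB.classB.bimodal
  have hc := hb.continuousOn
  have hm := hb.mapsTo
  have hcp : c ∈ Bimodal.phase := ⟨hb.zero_lt.le, (hb.lt.trans hb.lt_one).le⟩
  have hmin := hG.isMinimalSet_omega
  have hi := hB.injective_orbit.1
  have hsub := Bimodal.omega_subset_phase hm hcp
  exact ⟨hB.omega_eq, hsub, Bimodal.image_omega hc hm hcp, hmin, hmin.nonempty,
    isCompact_Icc.of_isClosed_subset Bimodal.isClosed_omega hsub,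
    Bimodal.perfect_omega hc hm hcp hB.recurrent_c hi,
    Bimodal.isTotallyDisconnected_omega hc hm hcp hB.recurrent_c hi hmin⟩
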